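/- Let $G=(V,E)$ be a finite simple graph and let $J=\{J_{uv}\ge 0: uv\in E\}$ be nonnegative interaction strengths. The (zero-field) Ising model is the probability measure on $\Omega=\{\pm1\}^V$ given by $$\mu(\sigma)=\frac1{Z(J)}\exp\Big(\sum_{uv\in E}J_{uv}\,\sigma(u)\sigma(v)\Big),\qquad \sigma\in\Omega,$$ where $Z(J)$ is the normalizing constant. The discrete-time Glauber (heat-bath) dynamics is the Markov chain on $\Omega$ which at each step chooses a vertex $v\in V$ uniformly at random and replaces the spin at $v$ by a sample from the $\mu$-conditional distribution given the spins at all other vertices. Let $P$ be its transition matrix, and let $$t_{\rm mix}^+(G,J)=\min\Big\{t\in\mathbb N:\ \big\|P^t(+,\cdot)-\mu\big\|_{\rm TV}\le \tfrac14\Big\}$$ be its mixing time started from the all-plus configuration $+$, where $\|\alpha-\beta\|_{\rm TV}=\frac12\sum_{x\in\Omega}|\alpha(x)-\beta(x)|$ is the total-variation distance. Then $$\inf_{G,J}\,t_{\rm mix}^+(G,J)\ \ge\ \big(\tfrac14+o(1)\big)\,n\log n\qquad(n\to\infty),$$ where the infimum is over all $n$-vertex graphs $G$ and all nonnegative interaction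 strengths $J$ on $G$. That is, there is a sequence $o(1)=o_n\to0$, depending only on $n$, such that $t_{\rm mix}^+(G,J)\ge(\frac14+o_n)\,n\log n$ for every $n$-vertex graph $G$ and all nonnegative interaction strengths $J$ on $G$. -/

import Mathlib

namespace IsingGlauber

noncomputable section

/-- Spin configurations on `V`: the two spins `+1` and `-1` are the units of `ℤ`. -/
abbrev Config (V : Type*) := V → ℤˣ

/-- The all-plus configuration. -/
def allPlus (V : Type*) : Config V := fun _ => 1

/-- The product `σ(u) σ(v)`, as a real number, of the spins at the two ends of `e = s(u, v)`. -/
def edgeSpin {V : Type*} (σ : Config V) (e : Sym2 V) : ℝ :=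
  (((e.map σ).mul : ℤˣ) : ℤ)

/-- The unnormalized Gibbs weight `exp (∑_{uv ∈ E} J_uv σ(u) σ(v))`; every edge is counted once. -/
def weight {V : Type*} [Fintype V] [DecidableEq V] (G : SimpleGraph V) [DecidableRel G.Adj]
    (J : Sym2 V → ℝ) (σ : Config V) : ℝ :=
  Real.exp (∑ e ∈ G.edgeFinset, J e * edgeSpin σ e)

/-- The partition function `Z(J)`. -/
def partitionFunction {V : Type*} [Fintype V] [DecidableEq V] (G : SimpleGraph V)
    [DecidableRel G.Adj] (J : Sym2 V → ℝ) : ℝ :=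
  ∑ σ : Config V, weight G J σ

/-- The Ising measure, given by its probability mass function. -/
def gibbs {V : Type*} [Fintype V] [DecidableEq V] (G : SimpleGraph V) [DecidableRel G.Adj]
    (J : Sym2 V → ℝ) (σ : Config V) : ℝ :=
  weight G J σ / partitionFunction G J

/-- For a positive probability mass function `μ`, the `μ`-conditional probability that the spin at
`v` is `s`, given that the spins at all the other vertices are those of `σ`. -/
def condSpin {V : Type*} [DecidableEq V] (μ : Config V → ℝ) (σ : Config V) (v : V) (s : ℤˣ) : ℝ :=
  μ (Function.update σ v s) / ∑ s' : ℤˣ, μ (Function.update σ v s')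

/-- Transition matrix of the discrete-time heat-bath Glauber dynamics for `μ`: a vertex `v` is chosen
uniformly at random, a new spin `s` at `v` is drawn from the conditional law given the other spins,
and the chain moves from `σ` to `Function.update σ v s`. -/
def glauber {V : Type*} [Fintype V] [DecidableEq V] (μ : Config V → ℝ) :
    Matrix (Config V) (Config V) ℝ :=
  fun σ τ => ∑ v : V, ∑ s : ℤˣ,
    (1 / (Fintype.card V : ℝ)) *
      (if Function.update σ v s = τ then condSpin μ σ v s else 0)

/-- Total-variation distance of two probability mass functions on a finite set. -/
def tvDist {α : Type*} [Fintype α] (μ ν : α → ℝ) : ℝ :=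
  (1 / 2) * ∑ x, |μ x - ν x|

/-- The mixing time, with initial state `x`, of the chain with transition matrix `P` and stationary
law `π`: the least `t` such that the law `P ^ t x` of the chain at time `t` is within
total-variation distance `1 / 4` of `π`. -/
def mixingTimeFrom {α : Type*} [Fintype α] [DecidableEq α] (P : Matrix α α ℝ) (π : α → ℝ)
    (x : α) : ℕ :=
  sInf {t : ℕ | tvDist ((P ^ t) x) π ≤ 1 / 4}

/-- The mixing time `t_mix^+(G, J)` of Glauber dynamics for the Ising model started from the all-plus
configuration. -/
def tmixPlus {V : Type*} [Fintype V] [DecidableEq V] (G : SimpleGraph V) [DecidableRel G.Adj]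
    (J : Sym2 V → ℝ) : ℕ :=
  mixingTimeFrom (glauber (gibbs G J)) (gibbs G J) (allPlus V)

end

end IsingGlauber

/-! Suppose the chain from all-plus is within `1 / 4` of equilibrium at a time `T ≤ (n log n) / 4`.
Two estimates on the equilibrium second moment `χ` of the magnetization then collide.

Upper bound (`susceptibility_le`). The observable `P ^ t m`, with `m` the magnetization, is
increasing and odd under the global flip, so its sup norm is attained at all-plus, and every `T`
steps halve it. By reversibility the decrements of `‖P ^ j m‖²` in `L²(μ)` are nonincreasing in `j`,
and the first is at most `4`, since one step moves `m` by at most `2`. Hence `χ ≤ 4kT + (n / 2 ^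
k)²`, which is `O(n log² n)` for `k` of order `log n`.

Lower bound (`half_le_of_tvDist_le`). The law at time `T` dominates `μ` conditioned on plus spins on
the random set `B` of vertices not yet updated (`eraseAverage_pow_plusExpect_le`). The size of `B`
concentrates around `M = n (1 - 1/n) ^ T`. By FKG the other spins are no lower than under `μ`, where
their sum has second moment at most `χ`. The event `m ≥ M / 4` therefore separates the two laws
unless `1/2 ≤ 32 χ / M² + 4 / M`.

Here `M ≥ n ^ (2/3)`, so `M²` far exceeds `n log² n`: a contradiction for large `n`. Only
monotonicity, reversibility and flip symmetry are used, so `IsFerromagnetic` replaces the Ising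
measure and all bounds are uniform in `G` and `J`. -/

namespace IsingGlauber

open Finset Matrix

section Spins

lemma sum_spins (F : ℤˣ → ℝ) : ∑ s, F s = F 1 + F (-1) := by
  have : (Finset.univ : Finset ℤˣ) = {1, -1} := by decide
  rw [this, Finset.sum_pair (by decide)]

lemma spin_le_one (s : ℤˣ) : s ≤ 1 := by
  rcases Int.units_eq_one_or s with rfl | rfl <;> decide

/-- The spin at `v`, as a real number. -/
def spin {V : Type*} (v : V) (σ : Config V) : ℝ := ((σ v : ℤ) : ℝ)

lemma spin_sq {V : Type*} (v : V) (σ : Config V) : spin v σ * spin v σ = 1 := by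
  unfold spin
  rcases Int.units_eq_one_or (σ v) with h | h <;> simp [h]

lemma abs_spin {V : Type*} (v : V) (σ : Config V) : |spin v σ| = 1 := by
  unfold spin
  rcases Int.units_eq_one_or (σ v) with h | h <;> simp [h]

lemma spin_neg {V : Type*} (v : V) (σ : Config V) : spin v (-σ) = -spin v σ := by
  simp [spin]

lemma monotone_spin {V : Type*} (v : V) : Monotone (spin (V := V) v) := by
  intro σ τ h
  have := Units.val_le_val.mpr (h v)
  unfold spin
  exact_mod_cast this

lemma le_allPlus {V : Type*} (σ : Config V) : σ ≤ allPlus V := fun v => spin_le_one (σ v)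

end Spins

/-! ### Heat-bath updates: reversibility, monotonicity and flip symmetry. -/

variable {V : Type*} [Fintype V] [DecidableEq V]

/-- The total magnetization. -/
def magnetization (σ : Config V) : ℝ := ∑ v, spin v σ

omit [DecidableEq V] in
lemma monotone_magnetization : Monotone (magnetization (V := V)) := fun _ _ h =>
  Finset.sum_le_sum fun v _ => monotone_spin v h

omit [DecidableEq V] in
lemma magnetization_neg (σ : Config V) : magnetization (-σ) = -magnetization σ := by
  simp [magnetization, spin_neg]

omit [DecidableEq V] in
lemma abs_magnetization_le (σ : Config V) : |magnetization σ| ≤ Fintype.card V := by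
  refine (Finset.abs_sum_le_sum_abs _ _).trans ?_
  simp [abs_spin]

/-- A positive, log-supermodular, spin-flip symmetric probability mass function. -/
structure IsFerromagnetic (μ : Config V → ℝ) : Prop where
  pos : ∀ σ, 0 < μ σ
  sum_eq_one : ∑ σ, μ σ = 1
  supermodular : ∀ σ τ, μ σ * μ τ ≤ μ (σ ⊓ τ) * μ (σ ⊔ τ)
  flip : ∀ σ, μ (-σ) = μ σ

/-- Heat-bath averaging of an observable at the vertex `v`. -/
noncomputable def siteUpdate (μ : Config V → ℝ) (v : V) (g : Config V → ℝ) (σ : Config V) : ℝ :=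
  ∑ s, condSpin μ σ v s * g (Function.update σ v s)

lemma glauber_mulVec (μ : Config V → ℝ) (g : Config V → ℝ) (σ : Config V) :
    (glauber μ *ᵥ g) σ = (1 / (Fintype.card V : ℝ)) * ∑ v, siteUpdate μ v g σ := by
  simp only [mulVec, dotProduct, glauber, siteUpdate, Finset.sum_mul, Finset.mul_sum]
  rw [Finset.sum_comm]
  refine Finset.sum_congr rfl fun v _ => ?_
  rw [Finset.sum_comm]
  refine Finset.sum_congr rfl fun s _ => ?_
  simp [mul_assoc]

omit [Fintype V] in
lemma condSpin_update (μ : Config V → ℝ) (σ : Config V) (v : V) (s s' : ℤˣ) :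
    condSpin μ (Function.update σ v s') v s = condSpin μ σ v s := by
  simp [condSpin]

omit [Fintype V] in
lemma siteUpdate_update (μ : Config V → ℝ) (σ : Config V) (v : V) (s : ℤˣ) (g : Config V → ℝ) :
    siteUpdate μ v g (Function.update σ v s) = siteUpdate μ v g σ := by
  simp [siteUpdate, condSpin_update]

omit [Fintype V] in
lemma siteUpdate_mul_of_invariant (μ : Config V → ℝ) (v : V) (g h : Config V → ℝ)
    (hh : ∀ σ s, h (Function.update σ v s) = h σ) (σ : Config V) :
    siteUpdate μ v (fun τ => h τ * g τ) σ = h σ * siteUpdate μ v g σ := by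
  simp only [siteUpdate, hh, Finset.mul_sum]
  exact Finset.sum_congr rfl fun s _ => by ring

lemma sum_sum_update (v : V) (F : Config V → ℝ) :
    ∑ σ, ∑ s, F (Function.update σ v s) = 2 * ∑ σ, F σ := by
  have h : ∑ p : Config V × ℤˣ, F (Function.update p.1 v p.2) = ∑ p : Config V × ℤˣ, F p.1 := by
    -- Swapping the stored spin with the spin at `v` is an involution of `Config V × ℤˣ`.
    refine Finset.sum_nbij' (fun p => (Function.update p.1 v p.2, p.1 v))
      (fun p => (Function.update p.1 v p.2, p.1 v)) ?_ ?_ ?_ ?_ ?_ <;> simp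
  rw [Fintype.sum_prod_type, Fintype.sum_prod_type] at h
  rw [h, Finset.mul_sum]
  exact Finset.sum_congr rfl fun σ _ => by rw [sum_spins]; ring

namespace IsFerromagnetic

variable {μ : Config V → ℝ} (hμ : IsFerromagnetic μ)
include hμ

lemma sum_update_pos (σ : Config V) (v : V) : 0 < ∑ s, μ (Function.update σ v s) :=
  Finset.sum_pos (fun _ _ => hμ.pos _) Finset.univ_nonempty

lemma condSpin_pos (σ : Config V) (v : V) (s : ℤˣ) : 0 < condSpin μ σ v s :=
  div_pos (hμ.pos _) (hμ.sum_update_pos σ v)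

lemma sum_condSpin (σ : Config V) (v : V) : ∑ s, condSpin μ σ v s = 1 := by
  simp only [condSpin, ← Finset.sum_div]
  exact div_self (hμ.sum_update_pos σ v).ne'

lemma siteUpdate_const (v : V) (c : ℝ) (σ : Config V) : siteUpdate μ v (fun _ => c) σ = c := by
  simp only [siteUpdate, ← Finset.sum_mul, hμ.sum_condSpin, one_mul]

omit hμ in
/-- The heat-bath averaging is self-adjoint. -/
lemma sum_mul_siteUpdate (v : V) (g h : Config V → ℝ) :
    ∑ σ, μ σ * (h σ * siteUpdate μ v g σ) = ∑ σ, μ σ * (siteUpdate μ v h σ * g σ) := by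
  -- Doubling the sum averages over the spin at `v`; the resulting expression is symmetric in `g`
  -- and `h`.
  have key : ∀ g h : Config V → ℝ, 2 * ∑ σ, μ σ * (h σ * siteUpdate μ v g σ) =
      ∑ σ, (∑ s, μ (Function.update σ v s) * h (Function.update σ v s)) *
        (∑ s, μ (Function.update σ v s) * g (Function.update σ v s)) /
          (∑ s, μ (Function.update σ v s)) := by
    intro g h
    rw [← sum_sum_update v]
    refine Finset.sum_congr rfl fun σ _ => ?_
    simp only [siteUpdate_update]
    simp only [siteUpdate, condSpin]
    rw [Finset.sum_mul, Finset.sum_div]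
    refine Finset.sum_congr rfl fun s _ => ?_
    rw [Finset.mul_sum, Finset.mul_sum, Finset.mul_sum, Finset.sum_div]
    refine Finset.sum_congr rfl fun s' _ => ?_
    ring
  have h1 := key g h
  have h2 := key h g
  have h3 : ∑ σ, μ σ * (siteUpdate μ v h σ * g σ) = ∑ σ, μ σ * (g σ * siteUpdate μ v h σ) :=
    Finset.sum_congr rfl fun σ _ => by ring
  rw [h3]
  have h4 : ∑ σ, (∑ s, μ (Function.update σ v s) * h (Function.update σ v s)) *
        (∑ s, μ (Function.update σ v s) * g (Function.update σ v s)) /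
          (∑ s, μ (Function.update σ v s)) =
      ∑ σ, (∑ s, μ (Function.update σ v s) * g (Function.update σ v s)) *
        (∑ s, μ (Function.update σ v s) * h (Function.update σ v s)) /
          (∑ s, μ (Function.update σ v s)) :=
    Finset.sum_congr rfl fun σ _ => by rw [mul_comm (∑ s, _ * h _)]
  linarith

lemma update_supermodular {σ τ : Config V} (hστ : σ ≤ τ) (v : V) :
    μ (Function.update σ v 1) * μ (Function.update τ v (-1)) ≤
      μ (Function.update σ v (-1)) * μ (Function.update τ v 1) := by
  have h := hμ.supermodular (Function.update σ v 1) (Function.update τ v (-1))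
  have h1 : Function.update σ v 1 ⊓ Function.update τ v (-1) = Function.update σ v (-1) := by
    funext u
    by_cases hu : u = v
    · subst hu; simp only [Pi.inf_apply, Function.update_self]; decide
    · simpa [hu] using hστ u
  have h2 : Function.update σ v 1 ⊔ Function.update τ v (-1) = Function.update τ v 1 := by
    funext u
    by_cases hu : u = v
    · subst hu; simp only [Pi.sup_apply, Function.update_self]; decide
    · simpa [hu] using hστ u
  rwa [h1, h2] at h

lemma condSpin_one_mono {σ τ : Config V} (hστ : σ ≤ τ) (v : V) :
    condSpin μ σ v 1 ≤ condSpin μ τ v 1 := by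
  unfold condSpin
  rw [div_le_div_iff₀ (hμ.sum_update_pos σ v) (hμ.sum_update_pos τ v), sum_spins, sum_spins]
  have := hμ.update_supermodular hστ v
  linarith

/-- A higher environment raises both values of `g` at the updated site, and by supermodularity it
also moves conditional mass from minus to plus. -/
lemma monotone_siteUpdate (v : V) {g : Config V → ℝ} (hg : Monotone g) :
    Monotone (siteUpdate μ v g) := by
  intro σ τ hστ
  have hup : ∀ s, g (Function.update σ v s) ≤ g (Function.update τ v s) := fun s =>
    hg (update_le_update_iff.mpr ⟨le_rfl, fun u _ => hστ u⟩)
  have hpm : g (Function.update τ v (-1)) ≤ g (Function.update τ v 1) :=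
    hg (update_le_update_iff.mpr ⟨by decide, fun u _ => le_rfl⟩)
  have e1 := hμ.sum_condSpin σ v
  have e2 := hμ.sum_condSpin τ v
  rw [sum_spins] at e1 e2
  simp only [siteUpdate, sum_spins]
  have p := hμ.condSpin_one_mono hστ v
  have a1 := mul_le_mul_of_nonneg_left (hup 1) (hμ.condSpin_pos σ v 1).le
  have a2 := mul_le_mul_of_nonneg_left (hup (-1)) (hμ.condSpin_pos σ v (-1)).le
  have a3 := mul_nonneg (sub_nonneg.mpr p) (sub_nonneg.mpr hpm)
  have b1 : condSpin μ σ v (-1) = 1 - condSpin μ σ v 1 := by linarith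
  have b2 : condSpin μ τ v (-1) = 1 - condSpin μ τ v 1 := by linarith
  rw [b1] at a2 ⊢
  rw [b2]
  nlinarith

lemma siteUpdate_flip (v : V) {g : Config V → ℝ} (hg : ∀ σ, g (-σ) = -g σ) (σ : Config V) :
    siteUpdate μ v g (-σ) = -siteUpdate μ v g σ := by
  have hup : ∀ s, Function.update (-σ) v s = -Function.update σ v (-s) := by
    intro s
    funext u
    by_cases hu : u = v
    · subst hu; simp
    · simp [hu]
  simp only [siteUpdate, condSpin, hup, hg, hμ.flip, sum_spins, neg_neg]
  rw [add_comm (μ (Function.update σ v (-1)))]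
  ring

/-! Powers of the transition matrix acting on observables. -/

lemma monotone_glauber_mulVec {g : Config V → ℝ} (hg : Monotone g) :
    Monotone (glauber μ *ᵥ g) := by
  intro σ τ h
  rw [glauber_mulVec, glauber_mulVec]
  exact mul_le_mul_of_nonneg_left
    (Finset.sum_le_sum fun v _ => hμ.monotone_siteUpdate v hg h) (by positivity)

lemma glauber_mulVec_flip {g : Config V → ℝ} (hg : ∀ σ, g (-σ) = -g σ) (σ : Config V) :
    (glauber μ *ᵥ g) (-σ) = -(glauber μ *ᵥ g) σ := by
  simp only [glauber_mulVec, hμ.siteUpdate_flip _ hg, Finset.sum_neg_distrib, mul_neg]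

omit hμ in
lemma pow_mulVec_succ (t : ℕ) (g : Config V → ℝ) :
    glauber μ ^ (t + 1) *ᵥ g = glauber μ *ᵥ (glauber μ ^ t *ᵥ g) := by
  rw [pow_succ', mulVec_mulVec]

lemma monotone_pow_mulVec {g : Config V → ℝ} (hg : Monotone g) (t : ℕ) :
    Monotone (glauber μ ^ t *ᵥ g) := by
  induction t with
  | zero => simpa using hg
  | succ t ih => rw [pow_mulVec_succ]; exact hμ.monotone_glauber_mulVec ih

lemma pow_mulVec_flip {g : Config V → ℝ} (hg : ∀ σ, g (-σ) = -g σ) (t : ℕ) (σ : Config V) :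
    (glauber μ ^ t *ᵥ g) (-σ) = -(glauber μ ^ t *ᵥ g) σ := by
  induction t generalizing σ with
  | zero => simpa using hg σ
  | succ t ih => rw [pow_mulVec_succ]; exact hμ.glauber_mulVec_flip ih σ

lemma glauber_nonneg (σ τ : Config V) : 0 ≤ glauber μ σ τ := by
  refine Finset.sum_nonneg fun v _ => Finset.sum_nonneg fun s _ => mul_nonneg (by positivity) ?_
  split_ifs
  · exact (hμ.condSpin_pos σ v s).le
  · exact le_rfl

lemma glauber_mulVec_const [Nonempty V] (c : ℝ) : glauber μ *ᵥ (fun _ => c) = fun _ => c := by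
  funext σ
  rw [glauber_mulVec]
  simp [hμ.siteUpdate_const]

omit hμ in
lemma sum_mul_glauber (g h : Config V → ℝ) :
    ∑ σ, μ σ * (h σ * (glauber μ *ᵥ g) σ) = ∑ σ, μ σ * ((glauber μ *ᵥ h) σ * g σ) := by
  have key : ∀ g h : Config V → ℝ, ∑ σ, μ σ * (h σ * (glauber μ *ᵥ g) σ) =
      (1 / (Fintype.card V : ℝ)) * ∑ v, ∑ σ, μ σ * (h σ * siteUpdate μ v g σ) := by
    intro g h
    rw [Finset.sum_comm, Finset.mul_sum]
    refine Finset.sum_congr rfl fun σ _ => ?_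
    rw [glauber_mulVec, Finset.mul_sum, Finset.mul_sum, Finset.mul_sum, Finset.mul_sum]
    exact Finset.sum_congr rfl fun v _ => by ring
  have h3 : ∑ σ, μ σ * ((glauber μ *ᵥ h) σ * g σ) = ∑ σ, μ σ * (g σ * (glauber μ *ᵥ h) σ) :=
    Finset.sum_congr rfl fun σ _ => by ring
  rw [h3, key, key]
  congr 1
  refine Finset.sum_congr rfl fun v _ => ?_
  rw [sum_mul_siteUpdate]
  exact Finset.sum_congr rfl fun σ _ => by ring

omit hμ in
lemma sum_mul_pow (t : ℕ) (g h : Config V → ℝ) :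
    ∑ σ, μ σ * (h σ * (glauber μ ^ t *ᵥ g) σ) = ∑ σ, μ σ * ((glauber μ ^ t *ᵥ h) σ * g σ) := by
  induction t generalizing h with
  | zero => simp
  | succ t ih =>
    rw [pow_mulVec_succ, sum_mul_glauber, ih, pow_succ, mulVec_mulVec]

lemma pow_mulVec_const [Nonempty V] (t : ℕ) (c : ℝ) :
    glauber μ ^ t *ᵥ (fun _ => c) = fun _ => c := by
  induction t with
  | zero => simp
  | succ t ih => rw [pow_mulVec_succ, ih, hμ.glauber_mulVec_const]

lemma sum_mul_pow_mulVec [Nonempty V] (t : ℕ) (g : Config V → ℝ) :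
    ∑ σ, μ σ * (glauber μ ^ t *ᵥ g) σ = ∑ σ, μ σ * g σ := by
  have h := sum_mul_pow (μ := μ) t g (fun _ => 1)
  rw [hμ.pow_mulVec_const] at h
  simpa using h

lemma sum_mul_eq_zero {g : Config V → ℝ} (hg : ∀ σ, g (-σ) = -g σ) : ∑ σ, μ σ * g σ = 0 := by
  have h : ∑ σ, μ σ * g σ = ∑ σ, μ (-σ) * g (-σ) :=
    (Equiv.sum_comp (Equiv.neg (Config V)) (fun σ => μ σ * g σ)).symm
  simp only [hμ.flip, hg, mul_neg, Finset.sum_neg_distrib] at h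
  linarith

end IsFerromagnetic

/-! ### Decay of the magnetization and the upper bound on the susceptibility. -/

lemma sq_magnetization_update_sub_le (σ : Config V) (v : V) (s : ℤˣ) :
    (magnetization (Function.update σ v s) - magnetization σ) ^ 2 ≤ 4 := by
  have h : magnetization (Function.update σ v s) - magnetization σ =
      spin v (Function.update σ v s) - spin v σ := by
    unfold magnetization
    rw [← Finset.sum_sub_distrib]
    refine Finset.sum_eq_single v (fun u _ hu => ?_) (fun h => absurd (Finset.mem_univ v) h)
    simp [spin, hu]
  rw [h]
  nlinarith [spin_sq v σ, spin_sq v (Function.update σ v s),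
    sq_nonneg (spin v (Function.update σ v s) + spin v σ)]

/-- The second moment of the magnetization. -/
noncomputable def susceptibility (μ : Config V → ℝ) : ℝ := ∑ σ, μ σ * magnetization σ ^ 2

namespace IsFerromagnetic

variable {μ : Config V → ℝ} (hμ : IsFerromagnetic μ)
include hμ

/-- Expand `‖g - P² g‖² ≥ 0` in `L²(μ)` and use `⟨g, P² g⟩ = ‖P g‖²`. -/
lemma sum_sq_glauber_convex (g : Config V → ℝ) :
    (∑ σ, μ σ * (glauber μ *ᵥ g) σ ^ 2) -
        ∑ σ, μ σ * (glauber μ *ᵥ (glauber μ *ᵥ g)) σ ^ 2 ≤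
      (∑ σ, μ σ * g σ ^ 2) - ∑ σ, μ σ * (glauber μ *ᵥ g) σ ^ 2 := by
  have h := sum_mul_glauber (μ := μ) (glauber μ *ᵥ g) g
  have h0 : 0 ≤ ∑ σ, μ σ * (g σ - (glauber μ *ᵥ (glauber μ *ᵥ g)) σ) ^ 2 :=
    Finset.sum_nonneg fun σ _ => mul_nonneg (hμ.pos σ).le (sq_nonneg _)
  have h1 : ∑ σ, μ σ * (g σ - (glauber μ *ᵥ (glauber μ *ᵥ g)) σ) ^ 2 =
      (∑ σ, μ σ * g σ ^ 2) - 2 * (∑ σ, μ σ * (g σ * (glauber μ *ᵥ (glauber μ *ᵥ g)) σ)) +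
        ∑ σ, μ σ * (glauber μ *ᵥ (glauber μ *ᵥ g)) σ ^ 2 := by
    rw [Finset.mul_sum, ← Finset.sum_sub_distrib, ← Finset.sum_add_distrib]
    exact Finset.sum_congr rfl fun σ _ => by ring
  have h2 : ∑ σ, μ σ * ((glauber μ *ᵥ g) σ * (glauber μ *ᵥ g) σ) =
      ∑ σ, μ σ * (glauber μ *ᵥ g) σ ^ 2 :=
    Finset.sum_congr rfl fun σ _ => by ring
  rw [h1, h, h2] at h0
  linarith

/-- The stationary mean square jump of `m` is `2χ - 2⟨m, P m⟩ ≤ 4`, and `‖m - P m‖² ≥ 0` bounds `χ -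
‖P m‖²` by it. -/
lemma susceptibility_sub_glauber_le [Nonempty V] :
    susceptibility μ - ∑ σ, μ σ * (glauber μ *ᵥ magnetization) σ ^ 2 ≤ 4 := by
  have hn : (Fintype.card V : ℝ) ≠ 0 := by exact_mod_cast Fintype.card_ne_zero
  -- The left side is the conditional expectation, from `σ`, of the squared jump of `m`.
  have hpt : ∀ σ, (glauber μ *ᵥ fun τ => magnetization τ ^ 2) σ -
      2 * magnetization σ * (glauber μ *ᵥ magnetization) σ + magnetization σ ^ 2 ≤ 4 := by
    intro σ
    have hsite : ∀ v, siteUpdate μ v (fun τ => magnetization τ ^ 2) σ -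
        2 * magnetization σ * siteUpdate μ v magnetization σ + magnetization σ ^ 2 ≤ 4 := by
      intro v
      have e := hμ.sum_condSpin σ v
      have b1 := mul_le_mul_of_nonneg_left (sq_magnetization_update_sub_le σ v 1)
        (hμ.condSpin_pos σ v 1).le
      have b2 := mul_le_mul_of_nonneg_left (sq_magnetization_update_sub_le σ v (-1))
        (hμ.condSpin_pos σ v (-1)).le
      rw [sum_spins] at e
      simp only [siteUpdate, sum_spins]
      have e' : condSpin μ σ v (-1) = 1 - condSpin μ σ v 1 := by linarith
      rw [e'] at b2 ⊢
      linarith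
    have hs := Finset.sum_le_sum fun v (_ : v ∈ (Finset.univ : Finset V)) => hsite v
    rw [Finset.sum_add_distrib, Finset.sum_sub_distrib, ← Finset.mul_sum] at hs
    simp only [Finset.sum_const, Finset.card_univ, nsmul_eq_mul] at hs
    rw [glauber_mulVec, glauber_mulVec]
    have hpos : (0 : ℝ) < Fintype.card V := by exact_mod_cast Fintype.card_pos
    have := mul_le_mul_of_nonneg_left hs (one_div_pos.mpr hpos).le
    have c1 : (1 / (Fintype.card V : ℝ)) * ((Fintype.card V : ℝ) * 4) = 4 := by field_simp
    have c2 : (1 / (Fintype.card V : ℝ)) * ((Fintype.card V : ℝ) * magnetization σ ^ 2) =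
      magnetization σ ^ 2 := by field_simp
    rw [c1, mul_add, c2] at this
    linarith
  have hsum := Finset.sum_le_sum fun σ (_ : σ ∈ (Finset.univ : Finset (Config V))) =>
    mul_le_mul_of_nonneg_left (hpt σ) (hμ.pos σ).le
  rw [← Finset.sum_mul, hμ.sum_eq_one] at hsum
  have hst := hμ.sum_mul_pow_mulVec 1 (fun τ => magnetization τ ^ 2)
  rw [pow_one] at hst
  have e1 : ∑ σ, μ σ * ((glauber μ *ᵥ fun τ => magnetization τ ^ 2) σ -
      2 * magnetization σ * (glauber μ *ᵥ magnetization) σ + magnetization σ ^ 2) =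
      (∑ σ, μ σ * (glauber μ *ᵥ fun τ => magnetization τ ^ 2) σ) + (∑ σ, μ σ * (
        magnetization σ ^ 2 - 2 * magnetization σ * (glauber μ *ᵥ magnetization) σ)) := by
    rw [← Finset.sum_add_distrib]
    exact Finset.sum_congr rfl fun σ _ => by ring
  rw [e1, hst, ← Finset.sum_add_distrib] at hsum
  refine le_trans ?_ (hsum.trans (one_mul _).le)
  rw [susceptibility, ← Finset.sum_sub_distrib]
  refine Finset.sum_le_sum fun σ _ => ?_
  nlinarith [mul_nonneg (hμ.pos σ).le
    (sq_nonneg (magnetization σ - (glauber μ *ᵥ magnetization) σ))]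

lemma susceptibility_sub_le [Nonempty V] (j : ℕ) :
    susceptibility μ - 4 * j ≤ ∑ σ, μ σ * (glauber μ ^ j *ᵥ magnetization) σ ^ 2 := by
  have hd : ∀ j : ℕ, (∑ σ, μ σ * (glauber μ ^ j *ᵥ magnetization) σ ^ 2) -
      ∑ σ, μ σ * (glauber μ ^ (j + 1) *ᵥ magnetization) σ ^ 2 ≤ 4 := by
    intro j
    induction j with
    | zero => simpa [susceptibility] using hμ.susceptibility_sub_glauber_le
    | succ j ih =>
      refine le_trans ?_ ih
      have := hμ.sum_sq_glauber_convex (glauber μ ^ j *ᵥ magnetization)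
      rw [pow_mulVec_succ (j + 1), pow_mulVec_succ j]
      exact this
  induction j with
  | zero => simp [susceptibility]
  | succ j ih =>
    have := hd j
    push_cast
    linarith

lemma abs_pow_mulVec_magnetization_le (t : ℕ) (σ : Config V) :
    |(glauber μ ^ t *ᵥ magnetization) σ| ≤ (glauber μ ^ t *ᵥ magnetization) (allPlus V) := by
  have hm := hμ.monotone_pow_mulVec monotone_magnetization t
  have h := hm (le_allPlus (-σ))
  rw [hμ.pow_mulVec_flip magnetization_neg] at h
  exact abs_le.mpr ⟨by linarith, hm (le_allPlus σ)⟩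

/-- Once the chain from all-plus is within `1 / 4` of equilibrium, the mean magnetization halves. -/
lemma magnetization_halving [Nonempty V] {T : ℕ}
    (hT : tvDist ((glauber μ ^ T) (allPlus V)) μ ≤ 1 / 4) (s : ℕ) :
    (glauber μ ^ (T + s) *ᵥ magnetization) (allPlus V) ≤
      (glauber μ ^ s *ᵥ magnetization) (allPlus V) / 2 := by
  have hz := hμ.sum_mul_eq_zero (magnetization_neg (V := V))
  have hz' := hμ.sum_mul_pow_mulVec s magnetization
  rw [hz] at hz'
  -- Subtracting `μ` costs nothing, because `P ^ s m` has mean zero under `μ`.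
  have e : (glauber μ ^ (T + s) *ᵥ magnetization) (allPlus V) =
      ∑ τ, ((glauber μ ^ T) (allPlus V) τ - μ τ) * (glauber μ ^ s *ᵥ magnetization) τ := by
    simp only [sub_mul, Finset.sum_sub_distrib, hz', sub_zero]
    rw [pow_add, ← mulVec_mulVec]
    rfl
  rw [e]
  have ha : 0 ≤ (glauber μ ^ s *ᵥ magnetization) (allPlus V) :=
    (abs_nonneg _).trans (hμ.abs_pow_mulVec_magnetization_le s (allPlus V))
  calc _ ≤ ∑ τ, |(glauber μ ^ T) (allPlus V) τ - μ τ| *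
        (glauber μ ^ s *ᵥ magnetization) (allPlus V) := by
        refine Finset.sum_le_sum fun τ _ => (le_abs_self _).trans ?_
        rw [abs_mul]
        exact mul_le_mul_of_nonneg_left (hμ.abs_pow_mulVec_magnetization_le s τ) (abs_nonneg _)
    _ = (∑ τ, |(glauber μ ^ T) (allPlus V) τ - μ τ|) *
        (glauber μ ^ s *ᵥ magnetization) (allPlus V) := by rw [Finset.sum_mul]
    _ ≤ (1 / 2) * (glauber μ ^ s *ᵥ magnetization) (allPlus V) := by
        refine mul_le_mul_of_nonneg_right ?_ ha
        unfold tvDist at hT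
        linarith
    _ = _ := by ring

lemma magnetization_mul_le [Nonempty V] {T : ℕ}
    (hT : tvDist ((glauber μ ^ T) (allPlus V)) μ ≤ 1 / 4) (k : ℕ) :
    (glauber μ ^ (k * T) *ᵥ magnetization) (allPlus V) ≤ Fintype.card V / 2 ^ k := by
  induction k with
  | zero => simpa using (abs_le.mp (abs_magnetization_le (allPlus V))).2
  | succ k ih =>
    have := hμ.magnetization_halving hT (k * T)
    rw [add_mul, one_mul, add_comm, pow_succ, ← div_div]
    linarith

/-- Fast mixing from all-plus forces small fluctuations of the magnetization at equilibrium. -/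
lemma susceptibility_le [Nonempty V] {T : ℕ}
    (hT : tvDist ((glauber μ ^ T) (allPlus V)) μ ≤ 1 / 4) (k : ℕ) :
    susceptibility μ ≤ 4 * (k * T) + (Fintype.card V / 2 ^ k) ^ 2 := by
  have h1 := hμ.susceptibility_sub_le (k * T)
  have h4 : ∑ σ, μ σ * (glauber μ ^ (k * T) *ᵥ magnetization) σ ^ 2 ≤
      (Fintype.card V / 2 ^ k) ^ 2 := by
    calc _ ≤ ∑ σ, μ σ * (Fintype.card V / 2 ^ k : ℝ) ^ 2 := by
          refine Finset.sum_le_sum fun σ _ => mul_le_mul_of_nonneg_left ?_ (hμ.pos σ).le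
          rw [← sq_abs]
          exact pow_le_pow_left₀ (abs_nonneg _)
            ((hμ.abs_pow_mulVec_magnetization_le _ σ).trans (hμ.magnetization_mul_le hT k)) 2
      _ = _ := by rw [← Finset.sum_mul, hμ.sum_eq_one, one_mul]
  push_cast at h1
  linarith

end IsFerromagnetic

/-! ### Conditioning on plus spins, and the set of vertices not yet updated. -/

/-- Indicator of the event that all the spins in `B` are plus. -/
def plusIndicator {V : Type*} (B : Finset V) (σ : Config V) : ℝ := if ∀ v ∈ B, σ v = 1 then 1 else 0

omit [Fintype V] [DecidableEq V] in
lemma plusIndicator_nonneg (B : Finset V) (σ : Config V) : 0 ≤ plusIndicator B σ := by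
  unfold plusIndicator; split_ifs <;> norm_num

omit [Fintype V] [DecidableEq V] in
lemma monotone_plusIndicator (B : Finset V) : Monotone (plusIndicator (V := V) B) := by
  intro σ τ h
  unfold plusIndicator
  split_ifs with h1 h2
  · exact le_rfl
  · exact absurd (fun v hv => le_antisymm (spin_le_one _) ((h1 v hv).symm.le.trans (h v))) h2
  · norm_num
  · exact le_rfl

omit [Fintype V] in
lemma plusIndicator_update {B : Finset V} {v : V} (hv : v ∉ B) (σ : Config V) (s : ℤˣ) :
    plusIndicator B (Function.update σ v s) = plusIndicator B σ := by
  unfold plusIndicator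
  congr 1
  refine propext (forall₂_congr fun u hu => ?_)
  rw [Function.update_of_ne (ne_of_mem_of_not_mem hu hv)]

omit [Fintype V] [DecidableEq V] in
lemma plusIndicator_mul_of_subset {B C : Finset V} (h : B ⊆ C) (σ : Config V) :
    plusIndicator B σ * plusIndicator C σ = plusIndicator C σ := by
  unfold plusIndicator
  by_cases h1 : ∀ v ∈ C, σ v = 1
  · rw [if_pos h1, if_pos fun v hv => h1 v (h hv), one_mul]
  · rw [if_neg h1, mul_zero]

/-- The expectation of `g` under `μ` conditioned on plus spins in `B`. -/
noncomputable def plusExpect (μ : Config V → ℝ) (B : Finset V) (g : Config V → ℝ) : ℝ :=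
  (∑ σ, μ σ * (plusIndicator B σ * g σ)) / ∑ σ, μ σ * plusIndicator B σ

lemma plusExpect_congr (μ : Config V → ℝ) (B : Finset V) {g h : Config V → ℝ}
    (hgh : ∀ σ, (∀ v ∈ B, σ v = 1) → g σ = h σ) : plusExpect μ B g = plusExpect μ B h := by
  unfold plusExpect
  congr 1
  refine Finset.sum_congr rfl fun σ _ => ?_
  by_cases hσ : ∀ v ∈ B, σ v = 1
  · rw [hgh σ hσ]
  · simp [plusIndicator, if_neg hσ]

/-- Averaging over the erasure of a uniformly random vertex. -/
noncomputable def eraseAverage (V : Type*) [Fintype V] [DecidableEq V] :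
    Module.End ℝ (Finset V → ℝ) where
  toFun φ B := (1 / (Fintype.card V : ℝ)) * ∑ v, φ (B.erase v)
  map_add' φ ψ := by
    funext B
    simp [Finset.sum_add_distrib, mul_add]
  map_smul' c φ := by
    funext B
    simp only [Pi.smul_apply, smul_eq_mul, RingHom.id_apply, ← Finset.mul_sum]
    ring

lemma eraseAverage_apply (φ : Finset V → ℝ) (B : Finset V) :
    eraseAverage V φ B = (1 / (Fintype.card V : ℝ)) * ∑ v, φ (B.erase v) := rfl

lemma eraseAverage_mono {φ ψ : Finset V → ℝ} (h : φ ≤ ψ) : eraseAverage V φ ≤ eraseAverage V ψ := by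
  intro B
  rw [eraseAverage_apply, eraseAverage_apply]
  exact mul_le_mul_of_nonneg_left (Finset.sum_le_sum fun v _ => h _) (by positivity)

lemma eraseAverage_pow_mono {φ ψ : Finset V → ℝ} (h : φ ≤ ψ) (t : ℕ) :
    (eraseAverage V ^ t) φ ≤ (eraseAverage V ^ t) ψ := by
  induction t with
  | zero => simpa using h
  | succ t ih =>
    rw [pow_succ', Module.End.mul_apply, Module.End.mul_apply]
    exact eraseAverage_mono ih

/-- Indicator of the event that `C` is contained in the argument. -/
def supersetIndicator (C B : Finset V) : ℝ := if C ⊆ B then 1 else 0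

/-- These eigenfunctions span the first two powers of the cardinality, so the moments of the
un-updated set can be read off from their eigenvalues. -/
lemma eraseAverage_supersetIndicator [Nonempty V] (C : Finset V) :
    eraseAverage V (supersetIndicator C) =
      (1 - (C.card : ℝ) / Fintype.card V) • supersetIndicator C := by
  have hn : (Fintype.card V : ℝ) ≠ 0 := by exact_mod_cast Fintype.card_ne_zero
  funext B
  rw [eraseAverage_apply, Pi.smul_apply, smul_eq_mul]
  by_cases h : C ⊆ B
  · have e : ∑ v, supersetIndicator C (B.erase v) = (Fintype.card V : ℝ) - C.card := by
      have : ∀ v, supersetIndicator C (B.erase v) = 1 - if v ∈ C then (1 : ℝ) else 0 := by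
        intro v
        simp only [supersetIndicator, Finset.subset_erase, h, true_and]
        split_ifs <;> simp_all
      simp [this]
    rw [e, supersetIndicator, if_pos h]
    field_simp
  · have e : ∀ v, supersetIndicator C (B.erase v) = 0 := by
      intro v
      simp [supersetIndicator, Finset.subset_erase, h]
    simp only [e]
    simp [ supersetIndicator, h]

lemma eraseAverage_pow_supersetIndicator [Nonempty V] (C : Finset V) (t : ℕ) :
    (eraseAverage V ^ t) (supersetIndicator C) =
      (1 - (C.card : ℝ) / Fintype.card V) ^ t • supersetIndicator C := by
  induction t with
  | zero => simp
  | succ t ih =>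
    rw [pow_succ', Module.End.mul_apply, ih, map_smul, eraseAverage_supersetIndicator, smul_smul,
      pow_succ]

lemma eraseAverage_pow_one [Nonempty V] (t : ℕ) :
    (eraseAverage V ^ t) (fun _ => 1) = fun _ => 1 := by
  have h := eraseAverage_pow_supersetIndicator (∅ : Finset V) t
  have e : supersetIndicator (∅ : Finset V) = fun _ => 1 := by
    funext B; simp [supersetIndicator]
  rw [e] at h
  simpa using h

lemma eraseAverage_pow_card [Nonempty V] (t : ℕ) :
    (eraseAverage V ^ t) (fun B => (B.card : ℝ)) univ =
      Fintype.card V * (1 - 1 / (Fintype.card V : ℝ)) ^ t := by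
  have e : (fun B : Finset V => (B.card : ℝ)) = ∑ v, supersetIndicator {v} := by
    funext B
    simp [supersetIndicator, Finset.sum_apply]
  rw [e, map_sum]
  simp [eraseAverage_pow_supersetIndicator, supersetIndicator]

lemma eraseAverage_pow_card_sq_le [Nonempty V] (t : ℕ) :
    (eraseAverage V ^ t) (fun B => (B.card : ℝ) ^ 2) univ ≤
      Fintype.card V * (1 - 1 / (Fintype.card V : ℝ)) ^ t +
        (Fintype.card V * (1 - 1 / (Fintype.card V : ℝ)) ^ t) ^ 2 := by
  have hn : (1 : ℝ) ≤ Fintype.card V := by exact_mod_cast Fintype.card_pos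
  have e : (fun B : Finset V => (B.card : ℝ) ^ 2) = ∑ u, ∑ v, supersetIndicator {u, v} := by
    funext B
    have : ∀ u v, supersetIndicator {u, v} B =
        (if u ∈ B then (1 : ℝ) else 0) * if v ∈ B then (1 : ℝ) else 0 := by
      intro u v
      simp only [supersetIndicator, Finset.insert_subset_iff, Finset.singleton_subset_iff]
      split_ifs <;> simp_all
    simp only [Finset.sum_apply, this, ← Finset.mul_sum, ← Finset.sum_mul]
    simp [sq]
  rw [e]
  simp only [map_sum, Finset.sum_apply, eraseAverage_pow_supersetIndicator, Pi.smul_apply,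
    smul_eq_mul]
  have hq : (0 : ℝ) ≤ 1 - 1 / (Fintype.card V : ℝ) := by
    rw [sub_nonneg, div_le_one (by linarith)]; exact hn
  set q := (1 - 1 / (Fintype.card V : ℝ)) with hqdef
  -- Survivals of distinct vertices are negatively correlated: `1 - 2/n ≤ (1 - 1/n)²`.
  have hterm : ∀ u v : V, (1 - (({u, v} : Finset V).card : ℝ) / Fintype.card V) ^ t *
      supersetIndicator {u, v} univ ≤ (if u = v then q ^ t else 0) + (q ^ 2) ^ t := by
    intro u v
    have h1 : supersetIndicator {u, v} (univ : Finset V) = 1 := by simp [supersetIndicator]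
    rw [h1, mul_one]
    by_cases huv : u = v
    · subst huv
      have : (0 : ℝ) ≤ (q ^ 2) ^ t := by positivity
      simp only [Finset.pair_eq_singleton, Finset.card_singleton, Nat.cast_one, if_true]
      linarith
    · rw [Finset.card_pair huv, if_neg huv, zero_add]
      by_cases h2 : (2 : ℝ) ≤ Fintype.card V
      · refine pow_le_pow_left₀ ?_ ?_ t
        · rw [sub_nonneg, div_le_one (by linarith)]; exact_mod_cast h2
        · rw [hqdef]
          have : (0 : ℝ) ≤ (1 / (Fintype.card V : ℝ)) ^ 2 := by positivity
          have e2 : (((2 : ℕ) : ℝ) / Fintype.card V) = 2 * (1 / (Fintype.card V : ℝ)) := by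
            push_cast; ring
          rw [e2]; nlinarith
      · exfalso
        apply h2
        have : ({u, v} : Finset V).card ≤ Fintype.card V := Finset.card_le_univ _
        rw [Finset.card_pair huv] at this
        exact_mod_cast this
  refine (Finset.sum_le_sum fun u _ => Finset.sum_le_sum fun v _ => hterm u v).trans (le_of_eq ?_)
  simp only [Finset.sum_add_distrib, Finset.sum_ite_eq, Finset.mem_univ, if_true,
    Finset.sum_const, Finset.card_univ, nsmul_eq_mul]
  rw [← pow_mul, mul_comm 2 t, pow_mul]
  ring

lemma sum_sub_sum_le_tvDist {α : Type*} [Fintype α] (ν π : α → ℝ) (g : α → ℝ)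
    (hg : ∀ x, |g x| ≤ 1) : ∑ x, ν x * g x - ∑ x, π x * g x ≤ 2 * tvDist ν π := by
  rw [tvDist, ← Finset.sum_sub_distrib]
  have : 2 * (1 / 2 * ∑ x, |ν x - π x|) = ∑ x, |ν x - π x| := by ring
  rw [this]
  refine Finset.sum_le_sum fun x _ => ?_
  rw [← sub_mul]
  refine (le_abs_self _).trans ?_
  rw [abs_mul]
  exact mul_le_of_le_one_right (abs_nonneg _) (hg x)

/-- Indicator of the event that the magnetization is at least `c`. -/
noncomputable def highMagnetization (c : ℝ) (σ : Config V) : ℝ :=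
  if c ≤ magnetization σ then 1 else 0

omit [DecidableEq V] in
lemma monotone_highMagnetization (c : ℝ) : Monotone (highMagnetization (V := V) c) := by
  intro σ τ h
  have := monotone_magnetization h
  unfold highMagnetization
  split_ifs <;> linarith

omit [DecidableEq V] in
lemma highMagnetization_nonneg (c : ℝ) (σ : Config V) : 0 ≤ highMagnetization c σ := by
  unfold highMagnetization; split_ifs <;> norm_num

omit [DecidableEq V] in
lemma abs_highMagnetization_le (c : ℝ) (σ : Config V) : |highMagnetization c σ| ≤ 1 := by
  unfold highMagnetization; split_ifs <;> norm_num

/-! ### Domination from all-plus and the second-moment lower bound. -/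

namespace IsFerromagnetic

variable {μ : Config V → ℝ} (hμ : IsFerromagnetic μ)
include hμ

lemma sum_plusIndicator_pos (B : Finset V) : 0 < ∑ σ, μ σ * plusIndicator B σ :=
  Finset.sum_pos' (fun σ _ => mul_nonneg (hμ.pos σ).le (plusIndicator_nonneg B σ))
    ⟨allPlus V, Finset.mem_univ _, by simp [plusIndicator, allPlus, hμ.pos]⟩

lemma plusExpect_empty (g : Config V → ℝ) : plusExpect μ ∅ g = ∑ σ, μ σ * g σ := by
  simp [plusExpect, plusIndicator, hμ.sum_eq_one]

lemma plusExpect_univ (g : Config V → ℝ) : plusExpect μ univ g = g (allPlus V) := by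
  have h : ∀ h : Config V → ℝ, ∑ σ, μ σ * (plusIndicator univ σ * h σ) =
      μ (allPlus V) * h (allPlus V) := by
    intro h
    rw [Finset.sum_eq_single (allPlus V)]
    · simp [plusIndicator, allPlus]
    · intro σ _ hσ
      have : ¬ ∀ v ∈ (univ : Finset V), σ v = 1 := fun hall =>
        hσ (funext fun v => hall v (Finset.mem_univ v))
      rw [plusIndicator, if_neg this, zero_mul, mul_zero]
    · simp
  have h1 := h fun _ => 1
  simp only [mul_one] at h1
  rw [plusExpect, h, h1, mul_comm, mul_div_assoc, div_self (hμ.pos _).ne', mul_one]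

/-- Conditioning on more plus spins increases the expectation of increasing observables. -/
lemma plusExpect_mono_set {B C : Finset V} (hBC : B ⊆ C) {g : Config V → ℝ} (hg : Monotone g)
    (hg0 : ∀ σ, 0 ≤ g σ) : plusExpect μ B g ≤ plusExpect μ C g := by
  -- FKG for the weight `μ` restricted to plus on `B`, which is still log-supermodular.
  have h := fkg g (plusIndicator C) (fun σ => μ σ * plusIndicator B σ)
    (fun σ => mul_nonneg (hμ.pos σ).le (plusIndicator_nonneg B σ)) hg0 (plusIndicator_nonneg C)
    hg (monotone_plusIndicator C) ?_
  · unfold plusExpect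
    rw [div_le_div_iff₀ (hμ.sum_plusIndicator_pos B) (hμ.sum_plusIndicator_pos C)]
    have e1 : ∀ σ, μ σ * plusIndicator B σ * plusIndicator C σ = μ σ * plusIndicator C σ := by
      intro σ; rw [mul_assoc, plusIndicator_mul_of_subset hBC]
    have e2 : ∀ σ, μ σ * plusIndicator B σ * (g σ * plusIndicator C σ) =
        μ σ * (plusIndicator C σ * g σ) := by
      intro σ; rw [mul_comm (g σ), ← mul_assoc, e1, mul_assoc]
    simp only [e1, e2] at h
    simp only [← mul_assoc] at h ⊢
    linarith
  · intro σ τ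
    by_cases hσ : ∀ v ∈ B, σ v = 1
    · by_cases hτ : ∀ v ∈ B, τ v = 1
      · have h1 : ∀ v ∈ B, (σ ⊓ τ) v = 1 := fun v hv => by simp [hσ v hv, hτ v hv]
        have h2 : ∀ v ∈ B, (σ ⊔ τ) v = 1 := fun v hv => by simp [hσ v hv, hτ v hv]
        simp only [plusIndicator, if_pos hσ, if_pos hτ, if_pos h1, if_pos h2, mul_one]
        exact hμ.supermodular σ τ
      · simp only [plusIndicator, if_neg hτ, mul_zero]
        exact mul_nonneg (mul_nonneg (hμ.pos _).le (plusIndicator_nonneg B _))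
          (mul_nonneg (hμ.pos _).le (plusIndicator_nonneg B _))
    · simp only [plusIndicator, if_neg hσ, mul_zero, zero_mul]
      exact mul_nonneg (mul_nonneg (hμ.pos _).le (plusIndicator_nonneg B _))
        (mul_nonneg (hμ.pos _).le (plusIndicator_nonneg B _))

lemma plusExpect_siteUpdate {B : Finset V} {v : V} (hv : v ∉ B) (g : Config V → ℝ) :
    plusExpect μ B (siteUpdate μ v g) = plusExpect μ B g := by
  unfold plusExpect
  rw [sum_mul_siteUpdate]
  congr 1
  refine Finset.sum_congr rfl fun σ _ => ?_
  have h := siteUpdate_mul_of_invariant μ v (fun _ => 1) (plusIndicator B)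
    (plusIndicator_update hv) σ
  rw [hμ.siteUpdate_const] at h
  simp only [mul_one] at h
  rw [h]

lemma siteUpdate_nonneg (v : V) {g : Config V → ℝ} (hg : ∀ σ, 0 ≤ g σ) (σ : Config V) :
    0 ≤ siteUpdate μ v g σ :=
  Finset.sum_nonneg fun s _ => mul_nonneg (hμ.condSpin_pos σ v s).le (hg _)

omit hμ in
lemma plusExpect_glauber (B : Finset V) (g : Config V → ℝ) :
    plusExpect μ B (glauber μ *ᵥ g) =
      (1 / (Fintype.card V : ℝ)) * ∑ v, plusExpect μ B (siteUpdate μ v g) := by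
  unfold plusExpect
  rw [← Finset.sum_div, ← mul_div_assoc]
  congr 1
  rw [Finset.sum_comm, Finset.mul_sum]
  refine Finset.sum_congr rfl fun σ _ => ?_
  rw [glauber_mulVec, Finset.mul_sum, Finset.mul_sum, Finset.mul_sum, Finset.mul_sum]
  exact Finset.sum_congr rfl fun v _ => by ring

/-- Once `v` leaves the conditioning set, resampling `v` preserves the conditional law; putting the
condition at `v` back only raises the expectation. -/
lemma eraseAverage_plusExpect_le (B : Finset V) {g : Config V → ℝ} (hg : Monotone g)
    (hg0 : ∀ σ, 0 ≤ g σ) :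
    eraseAverage V (fun B => plusExpect μ B g) B ≤ plusExpect μ B (glauber μ *ᵥ g) := by
  rw [eraseAverage_apply, plusExpect_glauber]
  refine mul_le_mul_of_nonneg_left (Finset.sum_le_sum fun v _ => ?_) (by positivity)
  rw [← hμ.plusExpect_siteUpdate (Finset.notMem_erase v B) g]
  exact hμ.plusExpect_mono_set (Finset.erase_subset v B) (hμ.monotone_siteUpdate v hg)
    (hμ.siteUpdate_nonneg v hg0)

/-- The law of the dynamics from all-plus dominates the equilibrium law conditioned on plus spins
at all the vertices that have not been updated. -/
lemma eraseAverage_pow_plusExpect_le (t : ℕ) {g : Config V → ℝ} (hg : Monotone g)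
    (hg0 : ∀ σ, 0 ≤ g σ) :
    (eraseAverage V ^ t) (fun B => plusExpect μ B g) univ ≤
      (glauber μ ^ t *ᵥ g) (allPlus V) := by
  induction t generalizing g with
  | zero => simp [hμ.plusExpect_univ]
  | succ t ih =>
    have hP0 : ∀ σ, 0 ≤ (glauber μ *ᵥ g) σ := fun σ =>
      Finset.sum_nonneg fun τ _ => mul_nonneg (hμ.glauber_nonneg σ τ) (hg0 τ)
    have h := ih (hμ.monotone_glauber_mulVec hg) hP0
    rw [mulVec_mulVec, ← pow_succ] at h
    refine le_trans ?_ h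
    rw [pow_succ, Module.End.mul_apply]
    exact eraseAverage_pow_mono (fun B => hμ.eraseAverage_plusExpect_le B hg hg0) t univ

/-- FKG for the spins, shifted by `1` to be nonnegative; flip symmetry kills the means. -/
lemma sum_mul_spin_spin_nonneg (u v : V) : 0 ≤ ∑ σ, μ σ * (spin u σ * spin v σ) := by
  have hz : ∀ w : V, ∑ σ, μ σ * spin w σ = 0 := fun w => hμ.sum_mul_eq_zero (spin_neg w)
  have hnn : ∀ w : V, (0 : Config V → ℝ) ≤ fun σ => spin w σ + 1 := by
    intro w σ
    have := (abs_le.mp (abs_spin w σ).le).1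
    simp only [Pi.zero_apply]
    linarith
  have hmono : ∀ w : V, Monotone fun σ : Config V => spin w σ + 1 := fun w _ _ h =>
    add_le_add_left (monotone_spin w h) 1
  have h := fkg (fun σ => spin u σ + 1) (fun σ => spin v σ + 1) μ (fun σ => (hμ.pos σ).le)
    (hnn u) (hnn v) (hmono u) (hmono v) hμ.supermodular
  have e : ∑ σ, μ σ * ((spin u σ + 1) * (spin v σ + 1)) =
      (∑ σ, μ σ * (spin u σ * spin v σ)) + ((∑ σ, μ σ * spin u σ) + (∑ σ, μ σ * spin v σ)) +
        ∑ σ, μ σ := by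
    simp only [← Finset.sum_add_distrib]
    exact Finset.sum_congr rfl fun σ _ => by ring
  rw [e] at h
  simp only [mul_add, mul_one, Finset.sum_add_distrib, hz, hμ.sum_eq_one] at h
  linarith

lemma sum_mul_sq_sum_spin_le (S : Finset V) :
    ∑ σ, μ σ * (∑ v ∈ S, spin v σ) ^ 2 ≤ susceptibility μ := by
  have key : ∀ S : Finset V, ∑ σ, μ σ * (∑ v ∈ S, spin v σ) ^ 2 =
      ∑ p ∈ S ×ˢ S, ∑ σ, μ σ * (spin p.1 σ * spin p.2 σ) := by
    intro S
    rw [Finset.sum_comm]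
    refine Finset.sum_congr rfl fun σ _ => ?_
    rw [sq, Finset.sum_mul_sum, ← Finset.sum_product', ← Finset.mul_sum]
  unfold susceptibility magnetization
  rw [key, key]
  exact Finset.sum_le_sum_of_subset_of_nonneg (Finset.subset_univ _ |>.trans (by simp))
    fun p _ _ => hμ.sum_mul_spin_spin_nonneg p.1 p.2

lemma sum_mul_highMagnetization_le {c : ℝ} (hc : 0 < c) :
    ∑ σ, μ σ * highMagnetization c σ ≤ susceptibility μ / c ^ 2 := by
  rw [susceptibility, Finset.sum_div]
  refine Finset.sum_le_sum fun σ _ => ?_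
  rw [mul_div_assoc]
  refine mul_le_mul_of_nonneg_left ?_ (hμ.pos σ).le
  unfold highMagnetization
  split_ifs with h
  · rw [one_le_div (by positivity)]
    exact pow_le_pow_left₀ hc.le h 2
  · positivity

lemma le_plusExpect_highMagnetization {c : ℝ} (hc : 0 < c) {B : Finset V}
    (hB : 2 * c ≤ B.card) :
    1 - susceptibility μ / c ^ 2 ≤ plusExpect μ B (highMagnetization c) := by
  -- On plus configurations of `B` this is `highMagnetization c`, but it ignores the spins in `B`,
  -- so the gain `B.card` survives when the conditioning is dropped.
  set h : Config V → ℝ := fun σ => if c - B.card ≤ ∑ v ∈ Bᶜ, spin v σ then 1 else 0 with hh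
  have hmono : Monotone h := by
    intro σ τ hστ
    have : ∑ v ∈ Bᶜ, spin v σ ≤ ∑ v ∈ Bᶜ, spin v τ :=
      Finset.sum_le_sum fun v _ => monotone_spin v hστ
    simp only [hh]
    split_ifs <;> linarith
  have h0 : ∀ σ, 0 ≤ h σ := by
    intro σ
    simp only [hh]
    split_ifs <;> norm_num
  have e : plusExpect μ B (highMagnetization c) = plusExpect μ B h := by
    refine plusExpect_congr μ B fun σ hσ => ?_
    have hm : magnetization σ = B.card + ∑ v ∈ Bᶜ, spin v σ := by
      rw [magnetization, ← Finset.sum_add_sum_compl B]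
      congr 1
      rw [Finset.sum_congr rfl fun v hv => by rw [spin, hσ v hv]]
      simp
    simp only [hh, highMagnetization, hm, sub_le_iff_le_add, add_comm (B.card : ℝ)]
  rw [e]
  refine le_trans ?_ (hμ.plusExpect_mono_set (Finset.empty_subset B) hmono h0)
  rw [hμ.plusExpect_empty]
  have hs : susceptibility μ / c ^ 2 ≥ (∑ σ, μ σ * (∑ v ∈ Bᶜ, spin v σ) ^ 2) / c ^ 2 :=
    div_le_div_of_nonneg_right (hμ.sum_mul_sq_sum_spin_le Bᶜ) (by positivity)
  refine (sub_le_sub_left hs 1).trans ?_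
  rw [← hμ.sum_eq_one, Finset.sum_div, ← Finset.sum_sub_distrib]
  refine Finset.sum_le_sum fun σ _ => ?_
  rw [mul_div_assoc, ← mul_one_sub]
  refine mul_le_mul_of_nonneg_left ?_ (hμ.pos σ).le
  simp only [hh]
  split_ifs with hcase
  · have : 0 ≤ (∑ v ∈ Bᶜ, spin v σ) ^ 2 / c ^ 2 := by positivity
    linarith
  -- Chebyshev: in this case the sum lies below `c - B.card ≤ -c`.
  · rw [sub_nonpos, one_le_div (by positivity)]
    push Not at hcase
    nlinarith

/-- Second-moment lower bound on the fluctuations at equilibrium when the dynamics from all-plus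
mixes by time `T`, in terms of the mean number of vertices that have not been updated. -/
lemma half_le_of_tvDist_le [Nonempty V] {T : ℕ}
    (hT : tvDist ((glauber μ ^ T) (allPlus V)) μ ≤ 1 / 4) {M : ℝ} (hM : 0 < M)
    (hMdef : M = Fintype.card V * (1 - 1 / (Fintype.card V : ℝ)) ^ T) :
    1 / 2 ≤ 32 * susceptibility μ / M ^ 2 + 4 / M := by
  set c := M / 4 with hc
  have hc0 : 0 < c := by positivity
  set χ := susceptibility μ
  have hχ : 0 ≤ χ := Finset.sum_nonneg fun σ _ => mul_nonneg (hμ.pos σ).le (sq_nonneg _)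
  -- A quadratic minorant in `B.card` builds in Chebyshev around `M`: its last term is at least `1`
  -- when `B.card < M / 2`. Only two moments are then needed.
  have hlow : (fun B : Finset V => 1 - χ / c ^ 2 - 4 / M ^ 2 * ((B.card : ℝ) - M) ^ 2) ≤
      fun B => plusExpect μ B (highMagnetization c) := by
    intro B
    by_cases hB : 2 * c ≤ B.card
    · have := hμ.le_plusExpect_highMagnetization hc0 hB
      have h2 : 0 ≤ 4 / M ^ 2 * ((B.card : ℝ) - M) ^ 2 := by positivity
      simp only
      linarith
    · have h1 : 0 ≤ plusExpect μ B (highMagnetization c) :=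
        div_nonneg (Finset.sum_nonneg fun σ _ => mul_nonneg (hμ.pos σ).le
          (mul_nonneg (plusIndicator_nonneg B σ) (highMagnetization_nonneg c σ)))
          (hμ.sum_plusIndicator_pos B).le
      have h2 : 0 ≤ χ / c ^ 2 := by positivity
      have h3 : 1 ≤ 4 / M ^ 2 * ((B.card : ℝ) - M) ^ 2 := by
        rw [div_mul_eq_mul_div, one_le_div (by positivity)]
        push Not at hB
        have : (B.card : ℝ) < M / 2 := by rw [hc] at hB; linarith
        nlinarith [sq_nonneg (M / 2 - B.card)]
      simp only
      linarith
  have h := (eraseAverage_pow_mono hlow T univ).trans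
    (hμ.eraseAverage_pow_plusExpect_le T (monotone_highMagnetization c)
      (highMagnetization_nonneg c))
  have e : (fun B : Finset V => 1 - χ / c ^ 2 - 4 / M ^ 2 * ((B.card : ℝ) - M) ^ 2) =
      (1 - χ / c ^ 2 - 4) • (fun _ => (1 : ℝ)) + (8 / M) • (fun B : Finset V => (B.card : ℝ)) -
        (4 / M ^ 2) • fun B : Finset V => (B.card : ℝ) ^ 2 := by
    funext B
    simp only [Pi.sub_apply, Pi.add_apply, Pi.smul_apply, smul_eq_mul]
    field_simp
    ring
  rw [e, map_sub, map_add, map_smul, map_smul, map_smul, eraseAverage_pow_one, Pi.sub_apply,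
    Pi.add_apply, Pi.smul_apply, Pi.smul_apply, Pi.smul_apply, eraseAverage_pow_card,
    ← hMdef] at h
  simp only [smul_eq_mul] at h
  have hsq := eraseAverage_pow_card_sq_le (V := V) T
  rw [← hMdef] at hsq
  have hsq' := mul_le_mul_of_nonneg_left hsq (show 0 ≤ 4 / M ^ 2 by positivity)
  have e3 : 4 / M ^ 2 * (M + M ^ 2) = 4 / M + 4 := by field_simp
  have e4 : 8 / M * M = 8 := by field_simp
  have htv := sum_sub_sum_le_tvDist ((glauber μ ^ T) (allPlus V)) μ (highMagnetization c)
    (abs_highMagnetization_le c)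
  have hup := hμ.sum_mul_highMagnetization_le hc0
  have e5 : (glauber μ ^ T *ᵥ highMagnetization c) (allPlus V) =
    ∑ σ, (glauber μ ^ T) (allPlus V) σ * highMagnetization c σ := rfl
  have e6 : 32 * χ / M ^ 2 = 2 * (χ / c ^ 2) := by rw [hc]; field_simp; ring
  rw [e6]
  rw [e3] at hsq'
  rw [e4, e5] at h
  linarith

end IsFerromagnetic

/-! ### Convergence to equilibrium. -/

namespace IsFerromagnetic

variable {μ : Config V → ℝ} (hμ : IsFerromagnetic μ)
include hμ

lemma glauber_update_pos [Nonempty V] (σ : Config V) (v : V) (s : ℤˣ) :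
    0 < glauber μ σ (Function.update σ v s) := by
  have hn : (0 : ℝ) < Fintype.card V := by exact_mod_cast Fintype.card_pos
  have hterm : ∀ u s', 0 ≤ (1 / (Fintype.card V : ℝ)) *
      (if Function.update σ u s' = Function.update σ v s then condSpin μ σ u s' else 0) := by
    intro u s'
    refine mul_nonneg (by positivity) ?_
    split_ifs
    · exact (hμ.condSpin_pos σ u s').le
    · exact le_rfl
  refine Finset.sum_pos' (fun u _ => Finset.sum_nonneg fun s' _ => hterm u s')
    ⟨v, Finset.mem_univ v, Finset.sum_pos' (fun s' _ => hterm v s') ⟨s, Finset.mem_univ s, ?_⟩⟩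
  rw [if_pos rfl]
  exact mul_pos (by positivity) (hμ.condSpin_pos σ v s)

lemma pow_nonneg_entry (t : ℕ) (σ τ : Config V) : 0 ≤ (glauber μ ^ t) σ τ := by
  induction t generalizing σ with
  | zero => rw [pow_zero, Matrix.one_apply]; split_ifs <;> norm_num
  | succ t ih =>
    rw [pow_succ', Matrix.mul_apply]
    exact Finset.sum_nonneg fun ρ _ => mul_nonneg (hμ.glauber_nonneg σ ρ) (ih ρ)

/-- Correct one disagreeing spin per step; spare steps resample a spin to its current value. -/
lemma pow_pos_entry [Nonempty V] (t : ℕ) (σ τ : Config V)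
    (h : (univ.filter fun v => σ v ≠ τ v).card ≤ t) : 0 < (glauber μ ^ t) σ τ := by
  induction t generalizing σ with
  | zero =>
    have : σ = τ := by
      funext v
      by_contra hv
      have hmem : v ∈ univ.filter fun v => σ v ≠ τ v :=
        Finset.mem_filter.mpr ⟨Finset.mem_univ v, hv⟩
      have := Finset.card_pos.mpr ⟨v, hmem⟩
      omega
    subst this
    simp
  | succ t ih =>
    obtain ⟨v, hv⟩ : ∃ v, (univ.filter fun u => Function.update σ v (τ v) u ≠ τ u).card ≤ t := by
      by_cases hne : ∃ v, σ v ≠ τ v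
      · obtain ⟨v, hv⟩ := hne
        refine ⟨v, ?_⟩
        have hlt : (univ.filter fun u => Function.update σ v (τ v) u ≠ τ u).card <
            (univ.filter fun u => σ u ≠ τ u).card := by
          refine Finset.card_lt_card ⟨fun u hu => ?_, fun hsub => ?_⟩
          · have hu' := (Finset.mem_filter.mp hu).2
            refine Finset.mem_filter.mpr ⟨Finset.mem_univ u, ?_⟩
            by_cases huv : u = v
            · subst huv; exact hv
            · rwa [Function.update_of_ne huv] at hu'
          · have := hsub (Finset.mem_filter.mpr ⟨Finset.mem_univ v, hv⟩)
            simp at this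
        omega
      · push Not at hne
        refine ⟨Classical.arbitrary V, ?_⟩
        rw [← hne, Function.update_eq_self]
        simp [hne]
    rw [pow_succ', Matrix.mul_apply]
    exact Finset.sum_pos' (fun ρ _ => mul_nonneg (hμ.glauber_nonneg σ ρ) (hμ.pow_nonneg_entry t ρ τ))
      ⟨_, Finset.mem_univ _, mul_pos (hμ.glauber_update_pos σ v (τ v)) (ih _ hv)⟩

lemma sum_pow_row [Nonempty V] (t : ℕ) (σ : Config V) : ∑ τ, (glauber μ ^ t) σ τ = 1 := by
  have h := congrFun (hμ.pow_mulVec_const t 1) σ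
  simpa [mulVec, dotProduct] using h

lemma sum_mul_pow_entry [Nonempty V] (t : ℕ) (τ : Config V) :
    ∑ σ, μ σ * (glauber μ ^ t) σ τ = μ τ := by
  have h := hμ.sum_mul_pow_mulVec t (Pi.single τ 1)
  simpa [Pi.single_apply] using h

/-- The dynamics from all-plus converges to equilibrium. -/
lemma exists_tvDist_le [Nonempty V] :
    ∃ T, tvDist ((glauber μ ^ T) (allPlus V)) μ ≤ 1 / 4 := by
  set N := Fintype.card V
  -- Doeblin's argument: the least entry `δ` of `P ^ N` is positive, so `N` steps contract total
  -- variation by `r = 1 - δ * Fintype.card (Config V)`.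
  obtain ⟨p, hp⟩ := Finite.exists_min fun p : Config V × Config V => (glauber μ ^ N) p.1 p.2
  set δ := (glauber μ ^ N) p.1 p.2
  have hδ : 0 < δ := hμ.pow_pos_entry N p.1 p.2 (Finset.card_le_univ _)
  have hmin : ∀ σ τ, δ ≤ (glauber μ ^ N) σ τ := fun σ τ => hp (σ, τ)
  set r := 1 - Fintype.card (Config V) * δ with hr
  have hrow : ∀ σ, ∑ τ, ((glauber μ ^ N) σ τ - δ) = r := by
    intro σ
    rw [Finset.sum_sub_distrib, hμ.sum_pow_row]
    simp [hr]
  have hr0 : 0 ≤ r := by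
    rw [← hrow (allPlus V)]
    exact Finset.sum_nonneg fun τ _ => sub_nonneg.mpr (hmin _ τ)
  have hr1 : r < 1 := by
    have : (0 : ℝ) < Fintype.card (Config V) := by exact_mod_cast Fintype.card_pos
    have := mul_pos this hδ
    linarith
  have hstep : ∀ t, tvDist ((glauber μ ^ (t + N)) (allPlus V)) μ ≤
      r * tvDist ((glauber μ ^ t) (allPlus V)) μ := by
    intro t
    have hd : ∑ σ, ((glauber μ ^ t) (allPlus V) σ - μ σ) = 0 := by
      rw [Finset.sum_sub_distrib, hμ.sum_pow_row, hμ.sum_eq_one, sub_self]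
    have hpt : ∀ τ, |(glauber μ ^ (t + N)) (allPlus V) τ - μ τ| ≤
        ∑ σ, |(glauber μ ^ t) (allPlus V) σ - μ σ| * ((glauber μ ^ N) σ τ - δ) := by
      intro τ
      have e : (glauber μ ^ (t + N)) (allPlus V) τ - μ τ =
          ∑ σ, ((glauber μ ^ t) (allPlus V) σ - μ σ) * ((glauber μ ^ N) σ τ - δ) := by
        simp only [mul_sub, Finset.sum_sub_distrib, ← Finset.sum_mul, hd, zero_mul, sub_zero]
        simp only [sub_mul, Finset.sum_sub_distrib, hμ.sum_mul_pow_entry]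
        rw [pow_add, Matrix.mul_apply]
      rw [e]
      refine (Finset.abs_sum_le_sum_abs _ _).trans (Finset.sum_le_sum fun σ _ => ?_)
      rw [abs_mul, abs_of_nonneg (sub_nonneg.mpr (hmin σ τ))]
    have hsum := Finset.sum_le_sum fun τ (_ : τ ∈ (univ : Finset (Config V))) => hpt τ
    rw [Finset.sum_comm] at hsum
    simp only [← Finset.mul_sum, hrow, ← Finset.sum_mul] at hsum
    unfold tvDist
    linarith
  have hpow : ∀ k : ℕ, tvDist ((glauber μ ^ (k * N)) (allPlus V)) μ ≤
      r ^ k * tvDist ((glauber μ ^ 0) (allPlus V)) μ := by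
    intro k
    induction k with
    | zero => simp
    | succ k ih =>
      rw [add_mul, one_mul, pow_succ', mul_assoc]
      exact (hstep (k * N)).trans (mul_le_mul_of_nonneg_left ih hr0)
  have hlim : Filter.Tendsto (fun k : ℕ => r ^ k * tvDist ((glauber μ ^ 0) (allPlus V)) μ)
      Filter.atTop (nhds (0 * tvDist ((glauber μ ^ 0) (allPlus V)) μ)) :=
    (tendsto_pow_atTop_nhds_zero_of_lt_one hr0 hr1).mul_const _
  rw [zero_mul] at hlim
  obtain ⟨k, hk⟩ := (hlim.eventually (gt_mem_nhds (show (0 : ℝ) < 1 / 4 by norm_num))).exists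
  exact ⟨k * N, (hpow k).trans hk.le⟩

end IsFerromagnetic

/-! ### The Ising measure is ferromagnetic. -/

section Ising

omit [Fintype V] [DecidableEq V] in
lemma edgeSpin_supermodular (σ τ : Config V) (e : Sym2 V) :
    edgeSpin σ e + edgeSpin τ e ≤ edgeSpin (σ ⊓ τ) e + edgeSpin (σ ⊔ τ) e := by
  have key : ∀ a b c d : ℤˣ, ((a * b : ℤˣ) : ℤ) + ((c * d : ℤˣ) : ℤ) ≤
      (((a ⊓ c) * (b ⊓ d) : ℤˣ) : ℤ) + (((a ⊔ c) * (b ⊔ d) : ℤˣ) : ℤ) := by decide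
  induction e with
  | _ u v =>
    simp only [edgeSpin, Sym2.map_mk, Sym2.mul_mk, Pi.inf_apply, Pi.sup_apply]
    exact_mod_cast key (σ u) (σ v) (τ u) (τ v)

omit [Fintype V] [DecidableEq V] in
lemma edgeSpin_neg (σ : Config V) (e : Sym2 V) : edgeSpin (-σ) e = edgeSpin σ e := by
  induction e with
  | _ u v => simp [edgeSpin, Sym2.map_mk, Sym2.mul_mk]

lemma isFerromagnetic_gibbs (G : SimpleGraph V) [DecidableRel G.Adj] (J : Sym2 V → ℝ)
    (hJ : ∀ e ∈ G.edgeSet, 0 ≤ J e) : IsFerromagnetic (gibbs G J) := by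
  have hw : ∀ σ, 0 < weight G J σ := fun σ => Real.exp_pos _
  have hZ : 0 < partitionFunction G J := Finset.sum_pos (fun σ _ => hw σ) Finset.univ_nonempty
  refine ⟨fun σ => div_pos (hw σ) hZ, ?_, fun σ τ => ?_, fun σ => ?_⟩
  · simp only [gibbs, ← Finset.sum_div]
    exact div_self hZ.ne'
  · simp only [gibbs, div_mul_div_comm]
    refine div_le_div_of_nonneg_right ?_ (mul_pos hZ hZ).le
    simp only [weight, ← Real.exp_add, ← Finset.sum_add_distrib]
    refine Real.exp_le_exp.mpr (Finset.sum_le_sum fun e he => ?_)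
    rw [← mul_add, ← mul_add]
    exact mul_le_mul_of_nonneg_left (edgeSpin_supermodular σ τ e)
      (hJ e (SimpleGraph.mem_edgeFinset.mp he))
  · simp only [gibbs, weight, edgeSpin_neg]

end Ising

/-! ### Asymptotics in `n`. -/

lemma le_mul_one_sub_pow {n T : ℕ} (hn : 4 ≤ n) (hT : (T : ℝ) ≤ 1 / 4 * (n * Real.log n)) :
    Real.exp (2 / 3 * Real.log n) ≤ n * (1 - 1 / (n : ℝ)) ^ T := by
  have hn' : (4 : ℝ) ≤ n := by exact_mod_cast hn
  -- The factor `4/3`, valid from `n = 4` on, turns the exponent `1 - 1/4` into `1 - 1/3 = 2/3`.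
  have hbase : Real.exp (-(4 / (3 * n))) ≤ 1 - 1 / (n : ℝ) := by
    have h1 := Real.add_one_le_exp (4 / (3 * n : ℝ))
    have h2 : 1 ≤ (1 - 1 / (n : ℝ)) * (4 / (3 * n : ℝ) + 1) := by
      have : (1 - 1 / (n : ℝ)) * (4 / (3 * n : ℝ) + 1) = 1 + (n - 4) / (3 * n ^ 2) := by
        field_simp
        ring
      rw [this]
      have : 0 ≤ ((n : ℝ) - 4) / (3 * n ^ 2) := div_nonneg (by linarith) (by positivity)
      linarith
    rw [Real.exp_neg, inv_le_iff_one_le_mul₀ (Real.exp_pos _)]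
    have h3 : (0 : ℝ) ≤ 1 - 1 / n := by
      rw [sub_nonneg, div_le_one (by linarith)]
      linarith
    exact h2.trans (mul_le_mul_of_nonneg_left h1 h3)
  calc Real.exp (2 / 3 * Real.log n) = n * Real.exp (-(1 / 3 * Real.log n)) := by
        conv_rhs => rw [← Real.exp_log (show (0 : ℝ) < n by linarith)]
        rw [Real.log_exp, ← Real.exp_add]
        congr 1
        ring
    _ ≤ n * Real.exp (T * -(4 / (3 * n))) := by
        refine mul_le_mul_of_nonneg_left (Real.exp_le_exp.mpr ?_) (by linarith)
        have : (T : ℝ) * (4 / (3 * n)) ≤ 1 / 4 * (n * Real.log n) * (4 / (3 * n)) :=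
          mul_le_mul_of_nonneg_right hT (by positivity)
        have e : 1 / 4 * (n * Real.log n) * (4 / (3 * n)) = 1 / 3 * Real.log n := by
          field_simp
        linarith
    _ ≤ _ := by
        rw [Real.exp_nat_mul]
        exact mul_le_mul_of_nonneg_left (pow_le_pow_left₀ (Real.exp_pos _).le hbase T)
          (by linarith)

/-- Mixing from all-plus in fewer than `n log n / 4` steps would make both terms in the
second-moment bound small. -/
lemma half_le_exp_of_tvDist_le [Nonempty V] {μ : Config V → ℝ} (hμ : IsFerromagnetic μ) {T n : ℕ}
    (hV : Fintype.card V = n) (hn : 4 ≤ n)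
    (hT : tvDist ((glauber μ ^ T) (allPlus V)) μ ≤ 1 / 4)
    (hTn : (T : ℝ) ≤ 1 / 4 * (n * Real.log n)) :
    1 / 2 ≤ 864 * ((Real.log n / 3) ^ 2 * Real.exp (-(Real.log n / 3))) +
      36 * ((Real.log n / 3) ^ 0 * Real.exp (-(Real.log n / 3))) := by
  have hn' : (4 : ℝ) ≤ n := by exact_mod_cast hn
  set y := Real.log n with hy
  have hexp : Real.exp y = n := Real.exp_log (by linarith)
  have hy1 : 1 ≤ y := by
    rw [hy, Real.le_log_iff_exp_le (by linarith)]
    linarith [Real.exp_one_lt_d9]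
  set M := (n : ℝ) * (1 - 1 / (n : ℝ)) ^ T with hM
  have hMge : Real.exp (2 / 3 * y) ≤ M := le_mul_one_sub_pow hn hTn
  have hM0 : 0 < M := (Real.exp_pos _).trans_le hMge
  have hmain := hμ.half_le_of_tvDist_le hT hM0 (by rw [hV])
  -- Since `2 log 2 > 1`, this gives `2 ^ k ≥ n`.
  set k := ⌈2 * y⌉₊ with hk
  have hk1 : 2 * y ≤ k := Nat.le_ceil _
  have hk2 : (k : ℝ) ≤ 3 * y := by linarith [Nat.ceil_lt_add_one (show 0 ≤ 2 * y by linarith)]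
  have hχ := hμ.susceptibility_le hT k
  rw [hV] at hχ
  have hpow : (n : ℝ) ≤ 2 ^ k := by
    rw [← hexp, ← Real.exp_log (show (0 : ℝ) < 2 by norm_num), ← Real.exp_nat_mul]
    refine Real.exp_le_exp.mpr ?_
    nlinarith [Real.log_two_gt_d9]
  have hfrac : ((n : ℝ) / 2 ^ k) ^ 2 ≤ 1 :=
    pow_le_one₀ (by positivity) ((div_le_one (by positivity)).mpr hpow)
  have hkT : (k : ℝ) * T ≤ 3 * y * (1 / 4 * (n * y)) :=
    mul_le_mul hk2 hTn (by positivity) (by linarith)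
  have hχ' : susceptibility μ ≤ 3 * y ^ 2 * Real.exp y + 1 := by rw [hexp]; linarith
  have hz : Real.exp (-(y / 3)) ≤ 1 := Real.exp_le_one_iff.mpr (by linarith)
  have hinv : 1 / M ≤ Real.exp (-(2 / 3 * y)) := by
    rw [Real.exp_neg, ← one_div]
    exact one_div_le_one_div_of_le (Real.exp_pos _) hMge
  have hinv2 : 1 / M ^ 2 ≤ Real.exp (-(4 / 3 * y)) := by
    have := pow_le_pow_left₀ (by positivity) hinv 2
    rw [← Real.exp_nat_mul, div_pow, one_pow] at this
    refine this.trans (le_of_eq ?_)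
    congr 1
    push_cast
    ring
  have e1 : Real.exp y * Real.exp (-(4 / 3 * y)) = Real.exp (-(y / 3)) := by
    rw [← Real.exp_add]; congr 1; ring
  have b1 : Real.exp (-(4 / 3 * y)) ≤ Real.exp (-(y / 3)) := Real.exp_le_exp.mpr (by linarith)
  have b2 : Real.exp (-(2 / 3 * y)) ≤ Real.exp (-(y / 3)) := Real.exp_le_exp.mpr (by linarith)
  have h1 : 32 * susceptibility μ / M ^ 2 ≤
      32 * (3 * y ^ 2 * Real.exp y + 1) * Real.exp (-(4 / 3 * y)) := by
    rw [div_eq_mul_one_div]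
    exact mul_le_mul (by linarith) hinv2 (by positivity) (by positivity)
  have e2 : 32 * (3 * y ^ 2 * Real.exp y + 1) * Real.exp (-(4 / 3 * y)) =
      96 * y ^ 2 * Real.exp (-(y / 3)) + 32 * Real.exp (-(4 / 3 * y)) := by
    rw [← e1]; ring
  have h2 : 4 / M ≤ 4 * Real.exp (-(2 / 3 * y)) := by
    rw [div_eq_mul_one_div]; linarith
  have e3 : 864 * ((y / 3) ^ 2 * Real.exp (-(y / 3))) = 96 * y ^ 2 * Real.exp (-(y / 3)) := by
    ring
  rw [e3, pow_zero, one_mul]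
  linarith

end IsingGlauber

theorem theorem1 :
    ∃ o : ℕ → ℝ, Filter.Tendsto o Filter.atTop (nhds 0) ∧
      ∀ (n : ℕ) (V : Type*) [Fintype V] [DecidableEq V], Fintype.card V = n →
        ∀ (G : SimpleGraph V) [DecidableRel G.Adj] (J : Sym2 V → ℝ),
          (∀ e ∈ G.edgeSet, 0 ≤ J e) →
            (1 / 4 + o n) * ((n : ℝ) * Real.log (n : ℝ)) ≤ (IsingGlauber.tmixPlus G J : ℝ) := by
  have hlim : Filter.Tendsto (fun n : ℕ =>
      864 * ((Real.log n / 3) ^ 2 * Real.exp (-(Real.log n / 3))) +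
        36 * ((Real.log n / 3) ^ 0 * Real.exp (-(Real.log n / 3)))) Filter.atTop
      (nhds (864 * 0 + 36 * 0)) := by
    have hz : Filter.Tendsto (fun n : ℕ => Real.log n / 3) Filter.atTop Filter.atTop :=
      (Real.tendsto_log_atTop.comp tendsto_natCast_atTop_atTop).atTop_div_const (by norm_num)
    exact (((Real.tendsto_pow_mul_exp_neg_atTop_nhds_zero 2).comp hz).const_mul 864).add
      (((Real.tendsto_pow_mul_exp_neg_atTop_nhds_zero 0).comp hz).const_mul 36)
  obtain ⟨N, hN⟩ := Filter.eventually_atTop.mp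
    (hlim.eventually (gt_mem_nhds (show (864 * 0 + 36 * 0 : ℝ) < 1 / 2 by norm_num)))
  -- For small `n` the value `-1/4` makes the bound trivial; beyond that no error term is needed.
  refine ⟨fun n => if max 4 N ≤ n then 0 else -(1 / 4), ?_, ?_⟩
  · refine tendsto_const_nhds.congr' ?_
    filter_upwards [Filter.eventually_ge_atTop (max 4 N)] with n hn
    rw [if_pos hn]
  · intro n V _ _ hV G _ J hJ
    by_cases hn : max 4 N ≤ n
    · have hn4 : 4 ≤ n := (le_max_left _ _).trans hn
      have : Nonempty V := Fintype.card_pos_iff.mp (by omega)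
      have hμ := IsingGlauber.isFerromagnetic_gibbs G J hJ
      have hT : IsingGlauber.tvDist ((IsingGlauber.glauber (IsingGlauber.gibbs G J) ^
          IsingGlauber.tmixPlus G J) (IsingGlauber.allPlus V)) (IsingGlauber.gibbs G J) ≤ 1 / 4 :=
        -- Convergence matters here: the infimum of an empty set of times would be `0`.
        Nat.sInf_mem hμ.exists_tvDist_le
      simp only [if_pos hn, add_zero]
      by_contra hlt
      push Not at hlt
      have h1 := IsingGlauber.half_le_exp_of_tvDist_le hμ hV hn4 hT hlt.le
      exact absurd (hN n ((le_max_right _ _).trans hn)) (not_lt.mpr h1)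
    · simp only [if_neg hn, add_neg_cancel, zero_mul]
      exact Nat.cast_nonneg _
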